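/- Let $(a_n)_{n\ge 0}$ be a greedy $s$-energy sequence for $s=1$ on the unit circle $S^1\subset\mathbb{C}$, that is, $a_0\in S^1$ is arbitrary and, for every $n\ge 0$, the point $a_{n+1}\in S^1$ satisfies $$\sum_{i=0}^{n}\frac{1}{|a_{n+1}-a_i|}=\inf_{z\in S^1}\sum_{i=0}^{n}\frac{1}{|z-a_i|}$$ (with $1/0=+\infty$; in particular the points $a_n$ are pairwise distinct). For $N\ge 1$ let $\alpha_N=(a_0,\dots,a_{N-1})$ and $$E_1(\alpha_N)=\sum_{0\le i\ne j\le N-1}\frac{1}{|a_i-a_j|}<\infty .$$ For $p\ge 1$ let $\Theta_p\subset[0,1]^p$ be the set of all vectors $\vec\theta=(\theta_1,\dots,\theta_p)$ for which there is an infinite sequence $\mathcal N$ of distinct integers of the form $N=2^{n_1}+2^{n_2}+\cdots+2^{n_p}$, $n_1>n_2>\cdots>n_p\ge 0$, such that $\lim_{N\in\mathcal N}2^{n_i}/N=\theta_i$ for all $i=1,\dots,p$. For $\vec\theta\in\Theta_p$ put $$K(\vec\theta)=2\log 2+\sum_{k=1}^{p}\theta_k^2\log(\theta_k/4)+2\sum_{k=1}^{p-1}\Big(\sum_{j=k+1}^{p}\theta_j\Big)\theta_k\log\theta_k,$$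 where the terms with $\theta_k=0$ are understood to be $0$, and let $$\kappa=\sup_{p\ge 1}\ \sup_{\vec\theta\in\Theta_p}K(\vec\theta).$$ Then $\kappa$ is finite, and, with $\gamma$ the Euler--Mascheroni constant, $$\limsup_{N\to\infty}\frac{E_1(\alpha_N)-\frac1\pi N^2\log N}{N^2}=\frac1\pi\big(\gamma-\log(\pi/2)+\kappa\big),$$ $$\liminf_{N\to\infty}\frac{E_1(\alpha_N)-\frac1\pi N^2\log N}{N^2}=\frac1\pi\big(\gamma-\log(\pi/2)\big).$$ Moreover $\kappa>0$; in particular the sequence $\big(E_1(\alpha_N)-\frac1\pi N^2\log N\big)/N^2$ does not converge. -/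

import Mathlib

open Filter Topology

noncomputable section

namespace GreedyCircle

/-- The unit circle `S¹` in the complex plane. -/
def unitCircle : Set ℂ := Metric.sphere (0 : ℂ) 1

/-- The Riesz `s`-kernel `1 / |x - y| ^ s` for `s > 0`, with values in `[0, ∞]`;
it is `∞` on the diagonal. -/
def rieszKernel (s : ℝ) (x y : ℂ) : ENNReal := (edist x y ^ s)⁻¹

/-- `a` is a greedy `s`-energy sequence on the unit circle: `a 0` is an arbitrary point of the
circle, and each `a (n + 1)` is a point of the circle that minimizes the potential
`z ↦ ∑_{i = 0}^{n} 1 / |z - a i| ^ s` on the circle. -/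
def IsGreedySeq (s : ℝ) (a : ℕ → ℂ) : Prop :=
  (∀ n, a n ∈ unitCircle) ∧
  ∀ n, ∑ i ∈ Finset.range (n + 1), rieszKernel s (a (n + 1)) (a i) =
    ⨅ z ∈ unitCircle, ∑ i ∈ Finset.range (n + 1), rieszKernel s z (a i)

/-- The Riesz `s`-energy `∑_{i ≠ j} 1 / |a i - a j| ^ s` of the first `N` points
`a 0, …, a (N - 1)`; the sum is over ordered pairs of distinct indices. -/
def energy (s : ℝ) (a : ℕ → ℂ) (N : ℕ) : ENNReal :=
  ∑ i ∈ Finset.range N, ∑ j ∈ (Finset.range N).erase i, rieszKernel s (a i) (a j)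

/-- The second order expression `(E₁(α_N) - (1/π) N² log N) / N²`. -/
def normalizedEnergy (a : ℕ → ℂ) (N : ℕ) : ℝ :=
  ((energy 1 a N).toReal - 1 / Real.pi * (N : ℝ) ^ 2 * Real.log N) / (N : ℝ) ^ 2

/-- The set `Θ_p` of all vectors `(θ_1, …, θ_p)` for which there is an infinite sequence of
(distinct, increasing) integers `N = 2 ^ n_1 + ⋯ + 2 ^ n_p` with `n_1 > ⋯ > n_p ≥ 0` along which
`2 ^ n_i / N → θ_i` for every `i`. -/
def Theta (p : ℕ) : Set (Fin p → ℝ) :=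
  {θ | ∃ (N : ℕ → ℕ) (n : ℕ → Fin p → ℕ), StrictMono N ∧
    (∀ m, StrictAnti (n m) ∧ N m = ∑ i, 2 ^ n m i) ∧
    ∀ i, Tendsto (fun m => (2 : ℝ) ^ n m i / (N m : ℝ)) atTop (𝓝 (θ i))}

/-- `K(θ) = 2 log 2 + ∑_k θ_k² log (θ_k / 4) + 2 ∑_k (∑_{j > k} θ_j) θ_k log θ_k`, with the
convention that the terms with `θ_k = 0` vanish (which holds here as `Real.log 0 = 0`).
The summand `k = p` of the last sum is zero, as its inner sum is empty. -/
def K {p : ℕ} (θ : Fin p → ℝ) : ℝ :=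
  2 * Real.log 2 + ∑ k, θ k ^ 2 * Real.log (θ k / 4) +
    2 * ∑ k, (∑ j ∈ Finset.Ioi k, θ j) * (θ k * Real.log (θ k))

/-- All the values `K(θ)` with `θ ∈ Θ_p` and `p ≥ 1`. -/
def valuesK : Set ℝ := {x | ∃ p : ℕ, 1 ≤ p ∧ ∃ θ ∈ Theta p, x = K θ}

/-- The constant `κ`, the supremum of `K(θ)` over all `p ≥ 1` and all `θ ∈ Θ_p`. -/
def kappa : ℝ := sSup valuesK

end GreedyCircle

end

noncomputable section

namespace GreedyCircle

/-! Convexity of the cosecant shows that the potential of a coset of `M`-th roots of unity is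
smallest exactly at the midpoints of its arcs, that is, on the opposite coset. Hence a greedy
sequence has a binary structure (`greedy_structure`): its first `M = 2 ^ n` points form a full
coset, the next ones lie in the opposite coset, and there they form a greedy sequence of their own,
because a minimizer of the potential of the new points automatically minimizes that of the old coset
as well. So the greedy minima satisfy `greedyMin (M + r) = midPot M + greedyMin r` for `r < M`, and
the energy of `N` points is twice the sum of the first `N` minima, whatever the choices made.

Writing the cosecant as `1 / x` plus a monotone regular part gives `rootSum M ≈ M (log M + c) / π`
along powers of two, with `c = rootConst`, and `midPot M = rootSum (2 * M) - rootSum M`. Inserted in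
the recursion, the constant `c` collects to `c N ^ 2` and the logarithms to `logMain N`, with an
error `o(N ^ 2)` (`tendsto_energyErr`). The second order coefficient is therefore `(c + osc N) / π +
o(1)`.

The theorem thus concerns the numbers `osc N`. They are nonnegative by a concavity inequality and
vanish at powers of two, which gives the lower limit. By `K_eq_osc`, `osc N` is `K` at the vector of
binary digits of `N` divided by `N`; since `K` is continuous, `valuesK` contains every `osc N` with
`N > 0` and consists of limits of such values, so the upper limit is governed by `kappa`. Finally
`osc 3 > 0`. -/

/-- The potential at `z` of the first `k` points of `a`. -/
def pot (a : ℕ → ℂ) (k : ℕ) (z : ℂ) : ENNReal :=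
  ∑ i ∈ Finset.range k, rieszKernel 1 z (a i)

/-- The potential of the `M`-th roots of unity at the midpoint of two consecutive ones. -/
def midPot (M : ℕ) : ℝ :=
  ∑ k ∈ Finset.range M, 1 / (2 * Real.sin (Real.pi / (2 * M) + Real.pi * k / M))

/-! ### Recursion along binary digits -/

/-- The function with `f 0 = 0` and `f (2 ^ n + r) = u n r + f r` for `r < 2 ^ n`. -/
def binRec (u : ℕ → ℕ → ℝ) : ℕ → ℝ
  | 0 => 0
  | k + 1 =>
    u (Nat.log 2 (k + 1)) (k + 1 - 2 ^ Nat.log 2 (k + 1)) +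
      binRec u (k + 1 - 2 ^ Nat.log 2 (k + 1))
  decreasing_by
    have : 0 < 2 ^ Nat.log 2 (k + 1) := by positivity
    omega

theorem binRec_zero (u : ℕ → ℕ → ℝ) : binRec u 0 = 0 := by
  rw [binRec]

theorem binRec_add (u : ℕ → ℕ → ℝ) {n r : ℕ} (hr : r < 2 ^ n) :
    binRec u (2 ^ n + r) = u n r + binRec u r := by
  have hl : Nat.log 2 (2 ^ n + r) = n := by
    rw [Nat.log_eq_iff (Or.inr ⟨by norm_num, by positivity⟩)]
    rw [pow_succ]
    omega
  obtain ⟨k, hk⟩ : ∃ k, 2 ^ n + r = k + 1 :=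
    ⟨2 ^ n + r - 1, by have : 0 < 2 ^ n := by positivity
                       omega⟩
  rw [hk, binRec, ← hk, hl]
  simp

theorem exists_two_pow_add {k : ℕ} (hk : 0 < k) : ∃ n r, r < 2 ^ n ∧ k = 2 ^ n + r := by
  refine ⟨Nat.log 2 k, k - 2 ^ Nat.log 2 k, ?_, ?_⟩
  · have := Nat.lt_pow_succ_log_self (b := 2) (by norm_num) k
    rw [pow_succ] at this
    have h2 := Nat.pow_log_le_self 2 hk.ne'
    omega
  · have h2 := Nat.pow_log_le_self 2 hk.ne'
    omega

/-! ### Convexity of the cosecant and the potential of roots of unity -/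

/-- Concavity of the sine, followed by the inequality between harmonic and arithmetic means. -/
theorem csc_midpoint {u v : ℝ} (hu : u ∈ Set.Ioo 0 Real.pi) (hv : v ∈ Set.Ioo 0 Real.pi) :
    1 / Real.sin ((u + v) / 2) ≤ (1 / Real.sin u + 1 / Real.sin v) / 2 := by
  have su := Real.sin_pos_of_mem_Ioo hu
  have sv := Real.sin_pos_of_mem_Ioo hv
  have sm : 0 < Real.sin ((u + v) / 2) :=
    Real.sin_pos_of_pos_of_lt_pi (by linarith [hu.1, hv.1]) (by linarith [hu.2, hv.2])
  have hs : Real.sin u + Real.sin v ≤ 2 * Real.sin ((u + v) / 2) := by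
    rw [Real.sin_add_sin]
    nlinarith [Real.cos_le_one ((u - v) / 2)]
  have h1 : 2 / (Real.sin u + Real.sin v) ≤ (1 / Real.sin u + 1 / Real.sin v) / 2 := by
    rw [div_le_iff₀ (by positivity)]
    field_simp
    nlinarith [sq_nonneg (Real.sin u - Real.sin v)]
  refine le_trans ?_ h1
  rw [div_le_div_iff₀ sm (by positivity)]
  linarith

theorem csc_midpoint_lt {u v : ℝ} (hu : u ∈ Set.Ioo 0 Real.pi) (hv : v ∈ Set.Ioo 0 Real.pi)
    (h : u ≠ v) :
    1 / Real.sin ((u + v) / 2) < (1 / Real.sin u + 1 / Real.sin v) / 2 := by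
  have su := Real.sin_pos_of_mem_Ioo hu
  have sv := Real.sin_pos_of_mem_Ioo hv
  have sm : 0 < Real.sin ((u + v) / 2) :=
    Real.sin_pos_of_pos_of_lt_pi (by linarith [hu.1, hv.1]) (by linarith [hu.2, hv.2])
  have hc : Real.cos ((u - v) / 2) < 1 := by
    rw [← Real.cos_zero, ← Real.cos_abs ((u - v) / 2)]
    refine Real.cos_lt_cos_of_nonneg_of_le_pi le_rfl ?_ ?_
    · rw [abs_le]; constructor <;> linarith [hu.1, hu.2, hv.1, hv.2]
    · exact abs_pos.2 (by intro h'; exact h (by linarith))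
  have hs : Real.sin u + Real.sin v < 2 * Real.sin ((u + v) / 2) := by
    rw [Real.sin_add_sin]
    nlinarith
  have h1 : 2 / (Real.sin u + Real.sin v) ≤ (1 / Real.sin u + 1 / Real.sin v) / 2 := by
    rw [div_le_iff₀ (by positivity)]
    field_simp
    nlinarith [sq_nonneg (Real.sin u - Real.sin v)]
  refine lt_of_lt_of_le ?_ h1
  rw [div_lt_div_iff₀ sm (by positivity)]
  linarith

theorem mem_Ioo_shift {M k : ℕ} (hk : k < M) {x : ℝ} (hx : x ∈ Set.Ioo 0 (Real.pi / M)) :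
    x + Real.pi * k / M ∈ Set.Ioo 0 Real.pi := by
  have hM : (0 : ℝ) < M := by exact_mod_cast (by omega : 0 < M)
  have h0 : 0 ≤ Real.pi * k / M := by positivity
  refine ⟨by linarith [hx.1], ?_⟩
  have hk' : (k : ℝ) + 1 ≤ M := by exact_mod_cast hk
  have : Real.pi / M + Real.pi * k / M ≤ Real.pi := by
    rw [← add_div, div_le_iff₀ hM]
    nlinarith [Real.pi_pos]
  linarith [hx.2]

theorem sum_csc_reflect {M : ℕ} (hM : 0 < M) (x : ℝ) :
    ∑ k ∈ Finset.range M, 1 / Real.sin (x + Real.pi * k / M) =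
      ∑ k ∈ Finset.range M, 1 / Real.sin (Real.pi / M - x + Real.pi * k / M) := by
  have hM : (M : ℝ) ≠ 0 := by exact_mod_cast hM.ne'
  rw [← Finset.sum_range_reflect]
  refine Finset.sum_congr rfl fun k hk => ?_
  have hk' : k + 1 ≤ M := Finset.mem_range.1 hk
  have hc : ((M - 1 - k : ℕ) : ℝ) = M - (k + 1) := by
    rw [Nat.sub_sub, Nat.cast_sub (by omega)]; push_cast; ring
  rw [hc, ← Real.sin_pi_sub]
  congr 2
  field_simp
  ring

/-- The potential of the `M`-th roots of unity at the argument `2 x`. -/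
def rootPot (M : ℕ) (x : ℝ) : ℝ :=
  ∑ k ∈ Finset.range M, 1 / (2 * Real.sin (x + Real.pi * k / M))

/-- Averaging with the reflected sum pairs the terms so that the `k`-th pair of angles has midpoint
`π / (2 M) + π k / M`, whatever `x` is. Midpoint convexity then applies term by term and yields
`midPot M`. -/
theorem rootPot_eq {M : ℕ} (hM : 0 < M) (x : ℝ) :
    rootPot M x = ∑ k ∈ Finset.range M, ((1 / Real.sin (x + Real.pi * k / M) +
      1 / Real.sin (Real.pi / M - x + Real.pi * k / M)) / 2) / 2 := by
  have : rootPot M x = (∑ k ∈ Finset.range M, 1 / Real.sin (x + Real.pi * k / M)) / 2 := by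
    rw [rootPot, Finset.sum_div]
    refine Finset.sum_congr rfl fun k _ => ?_
    rw [div_div, mul_comm]
  rw [this, ← Finset.sum_div, ← Finset.sum_div, Finset.sum_add_distrib, ← sum_csc_reflect hM]
  ring

theorem midPot_term {M : ℕ} (k : ℕ) (x : ℝ) :
    1 / (2 * Real.sin (Real.pi / (2 * M) + Real.pi * k / M)) =
    1 / Real.sin ((x + Real.pi * k / M + (Real.pi / M - x + Real.pi * k / M)) / 2) / 2 := by
  rw [div_div, mul_comm (Real.sin _) 2]
  congr 3
  rw [mul_comm 2, ← div_div]
  ring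

theorem midPot_le_rootPot {M : ℕ} {x : ℝ} (hx : x ∈ Set.Ioo 0 (Real.pi / M)) :
    midPot M ≤ rootPot M x := by
  rcases Nat.eq_zero_or_pos M with rfl | hM
  · simp [midPot, rootPot]
  rw [rootPot_eq hM, midPot]
  refine Finset.sum_le_sum fun k hk => ?_
  rw [midPot_term k x]
  have hk := Finset.mem_range.1 hk
  linarith [csc_midpoint (mem_Ioo_shift hk hx)
    (mem_Ioo_shift hk (x := Real.pi / M - x) ⟨by linarith [hx.2], by linarith [hx.1]⟩)]

theorem midPot_lt_rootPot {M : ℕ} (hM : 0 < M) {x : ℝ} (hx : x ∈ Set.Ioo 0 (Real.pi / M))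
    (hne : x ≠ Real.pi / (2 * M)) :
    midPot M < rootPot M x := by
  rw [rootPot_eq hM, midPot]
  refine Finset.sum_lt_sum_of_nonempty (by simpa using hM.ne') fun k hk => ?_
  rw [midPot_term k x]
  have hk := Finset.mem_range.1 hk
  have := csc_midpoint_lt (mem_Ioo_shift hk hx)
    (mem_Ioo_shift hk (x := Real.pi / M - x) ⟨by linarith [hx.2], by linarith [hx.1]⟩) (by
      intro h
      apply hne
      rw [mul_comm 2, ← div_div]
      linarith)
  linarith

theorem rootPot_mid (M : ℕ) : rootPot M (Real.pi / (2 * M)) = midPot M := rfl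

theorem midPot_nonneg (M : ℕ) : 0 ≤ midPot M := by
  refine Finset.sum_nonneg fun k hk => ?_
  have hk := Finset.mem_range.1 hk
  have hM : (0 : ℝ) < M := by exact_mod_cast (by omega : 0 < M)
  have hx : Real.pi / (2 * M) ∈ Set.Ioo 0 (Real.pi / M) := by
    have := Real.pi_pos
    refine ⟨by positivity, ?_⟩
    exact div_lt_div_of_pos_left this hM (by linarith)
  have := Real.sin_pos_of_mem_Ioo (mem_Ioo_shift hk hx)
  positivity

/-! ### The kernel and cosets of roots of unity -/

theorem rieszKernel_one_eq (x y : ℂ) : rieszKernel 1 x y = (edist x y)⁻¹ := by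
  simp [rieszKernel]

theorem rieszKernel_one_of_ne {x y : ℂ} (h : x ≠ y) :
    rieszKernel 1 x y = ENNReal.ofReal (1 / dist x y) := by
  rw [rieszKernel_one_eq, edist_dist, one_div, ENNReal.ofReal_inv_of_pos (dist_pos.2 h)]

theorem rieszKernel_comm (x y : ℂ) : rieszKernel 1 x y = rieszKernel 1 y x := by
  rw [rieszKernel_one_eq, rieszKernel_one_eq, edist_comm]

theorem rieszKernel_self (x : ℂ) : rieszKernel 1 x x = ⊤ := by
  simp [rieszKernel_one_eq]

theorem continuous_pot (a : ℕ → ℂ) (k : ℕ) : Continuous (pot a k) := by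
  unfold pot
  refine continuous_finsetSum _ fun i _ => ?_
  simp only [rieszKernel_one_eq]
  exact continuous_inv.comp (continuous_id.edist continuous_const)

theorem exists_minimizer (a : ℕ → ℂ) (k : ℕ) :
    ∃ z ∈ unitCircle, ∀ y ∈ unitCircle, pot a k z ≤ pot a k y := by
  have hc : IsCompact unitCircle := isCompact_sphere 0 1
  have hn : unitCircle.Nonempty := ⟨1, by simp [unitCircle]⟩
  obtain ⟨z, hz, h⟩ := hc.exists_isMinOn hn (continuous_pot a k).continuousOn
  exact ⟨z, hz, fun y hy => h hy⟩

theorem norm_exp_mul_I_sub_one (x : ℝ) (hx : x ∈ Set.Ioo 0 Real.pi) :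
    ‖Complex.exp ((2 * x : ℝ) * Complex.I) - 1‖ = 2 * Real.sin x := by
  have := Complex.norm_exp_I_mul_ofReal_sub_one (2 * x)
  rw [mul_comm, this]
  have := Real.sin_pos_of_mem_Ioo hx
  simp [abs_of_pos this]

/-- The coset of `M`-th roots of unity through `c`, as a finite set. -/
def rootCoset (M : ℕ) (c : ℂ) : Finset ℂ := (Polynomial.nthRoots M (c ^ M)).toFinset

theorem sum_rootCoset {M : ℕ} (hM : 0 < M) {c : ℂ} (b : ℕ → ℂ)
    (hb : ∀ i < M, b i ^ M = c ^ M) (hinj : ∀ i < M, ∀ j < i, b i ≠ b j) (f : ℂ → ENNReal) :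
    ∑ i ∈ Finset.range M, f (b i) = ∑ y ∈ rootCoset M c, f y := by
  have hinj' : Set.InjOn b (Finset.range M) := by
    intro i hi j hj h
    simp only [Finset.coe_range, Set.mem_Iio] at hi hj
    rcases lt_trichotomy i j with h' | h' | h'
    · exact absurd h.symm (hinj j hj i h')
    · exact h'
    · exact absurd h (hinj i hi j h')
  have himg : (Finset.range M).image b = rootCoset M c := by
    apply Finset.eq_of_subset_of_card_le
    · intro y hy
      obtain ⟨i, hi, rfl⟩ := Finset.mem_image.1 hy
      simp only [rootCoset, Multiset.mem_toFinset]
      rw [Polynomial.mem_nthRoots hM]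
      exact hb i (Finset.mem_range.1 hi)
    · rw [Finset.card_image_of_injOn hinj', Finset.card_range]
      exact (Multiset.toFinset_card_le _).trans (Polynomial.card_nthRoots M _)
  rw [← himg, Finset.sum_image hinj']

theorem exp_root_pow {M : ℕ} (hM : 0 < M) (k : ℤ) :
    Complex.exp ((2 * (Real.pi * k / M) : ℝ) * Complex.I) ^ M = 1 := by
  have hM' : (M : ℂ) ≠ 0 := by exact_mod_cast hM.ne'
  rw [← Complex.exp_nat_mul, Complex.exp_eq_one_iff]
  refine ⟨k, ?_⟩
  push_cast
  field_simp

/-- The potential of a coset of roots of unity in terms of the angular distance to one of its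
points. -/
theorem coset_pot {M : ℕ} (hM : 0 < M) {c w : ℂ} (hw : ‖w‖ = 1) (hwc : w ^ M = c ^ M) {x : ℝ}
    (hx : x ∈ Set.Ioo 0 (Real.pi / M)) :
    ∑ y ∈ rootCoset M c, rieszKernel 1 (w * Complex.exp ((2 * x : ℝ) * Complex.I)) y =
      ENNReal.ofReal (rootPot M x) := by
  have hM' : (0 : ℝ) < M := by exact_mod_cast hM
  have hw0 : w ≠ 0 := by rintro rfl; simp at hw
  -- The coset is enumerated clockwise from `w`, so the half-angles from its points to the given
  -- point are `x + π k / M`, all in `(0, π)`, where the chord is twice the sine without an absolute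
  -- value.
  set b : ℕ → ℂ := fun k => w * Complex.exp ((2 * (Real.pi * (-k : ℤ) / M) : ℝ) * Complex.I)
    with hbdef
  have hbs : ∀ i j : ℕ, b i = b j → (i : ℤ) ≡ j [ZMOD M] := by
    intro i j h
    have h := mul_left_cancel₀ hw0 h
    rw [Complex.exp_eq_exp_iff_exists_int] at h
    obtain ⟨n, hn⟩ := h
    have hM'' : (M : ℂ) ≠ 0 := by exact_mod_cast hM.ne'
    have hpi : (Real.pi : ℂ) ≠ 0 := by exact_mod_cast Real.pi_ne_zero
    have : ((j : ℂ)) - i = n * M := by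
      push_cast at hn
      have hI := Complex.I_ne_zero
      field_simp at hn
      linear_combination hn
    have h2 : (j : ℤ) - i = n * M := by exact_mod_cast this
    exact Int.modEq_iff_dvd.2 ⟨n, by rw [h2]; ring⟩
  rw [← sum_rootCoset hM b]
  · rw [rootPot, ENNReal.ofReal_sum_of_nonneg]
    · refine Finset.sum_congr rfl fun k hk => ?_
      have hk := Finset.mem_range.1 hk
      have hmem := mem_Ioo_shift hk hx
      have hd : dist (w * Complex.exp ((2 * x : ℝ) * Complex.I)) (b k) =
          2 * Real.sin (x + Real.pi * k / M) := by
        rw [← norm_exp_mul_I_sub_one _ hmem, dist_eq_norm]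
        have hb1 : ‖b k‖ = 1 := by 
          simp only [hbdef, norm_mul, hw, Complex.norm_exp_ofReal_mul_I, mul_one]
        have : w * Complex.exp ((2 * x : ℝ) * Complex.I) - b k =
            b k * (Complex.exp ((2 * (x + Real.pi * k / M) : ℝ) * Complex.I) - 1) := by
          rw [mul_sub, mul_one, hbdef]
          simp only
          rw [mul_assoc, ← Complex.exp_add]
          congr 3
          push_cast
          ring
        rw [this, norm_mul, hb1, one_mul]
      rw [rieszKernel_one_of_ne, hd]
      rw [← dist_pos, hd]
      have := Real.sin_pos_of_mem_Ioo hmem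
      positivity
    · intro k hk
      have := Real.sin_pos_of_mem_Ioo (mem_Ioo_shift (Finset.mem_range.1 hk) hx)
      positivity
  · intro i _
    rw [mul_pow, exp_root_pow hM, mul_one, hwc]
  · intro i hi j hj h
    have := hbs i j h
    have := (Int.natCast_modEq_iff.1 this).eq_of_lt_of_lt hi (by omega)
    omega

/-- Here `w` is the last point of the coset met before `z` going counterclockwise; the floor finds
its index. -/
theorem exists_coset_rep {M : ℕ} (hM : 0 < M) {c z : ℂ} (hc : ‖c‖ = 1) (hz : ‖z‖ = 1) :
    ∃ w : ℂ, ‖w‖ = 1 ∧ w ^ M = c ^ M ∧ ∃ x : ℝ, 0 ≤ x ∧ x < Real.pi / M ∧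
      z = w * Complex.exp ((2 * x : ℝ) * Complex.I) := by
  have hM' : (0 : ℝ) < M := by exact_mod_cast hM
  have hc0 : c ≠ 0 := by rintro rfl; simp at hc
  have hpi := Real.pi_pos
  obtain ⟨φ, hφ⟩ : ∃ φ : ℝ, z = c * Complex.exp (φ * Complex.I) := by
    have : ‖z / c‖ = 1 := by rw [norm_div, hz, hc, div_one]
    obtain ⟨φ, hφ⟩ := (Complex.norm_eq_one_iff (z / c)).1 this
    exact ⟨φ, by rw [hφ]; field_simp⟩
  set j : ℤ := ⌊φ * M / (2 * Real.pi)⌋ with hj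
  have h1 := Int.floor_le (φ * M / (2 * Real.pi))
  have h2 := Int.lt_floor_add_one (φ * M / (2 * Real.pi))
  rw [← hj] at h1 h2
  rw [le_div_iff₀ (by positivity)] at h1
  rw [div_lt_iff₀ (by positivity)] at h2
  refine ⟨c * Complex.exp ((2 * (Real.pi * j / M) : ℝ) * Complex.I), ?_, ?_,
    φ / 2 - Real.pi * j / M, ?_, ?_, ?_⟩
  · rw [norm_mul, hc, Complex.norm_exp_ofReal_mul_I, mul_one]
  · rw [mul_pow, exp_root_pow hM, mul_one]
  · rw [sub_nonneg, div_le_iff₀ hM']; linarith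
  · rw [sub_lt_iff_lt_add, ← add_div, lt_div_iff₀ hM']; nlinarith
  · rw [hφ, mul_assoc, ← Complex.exp_add]
    congr 2
    push_cast
    ring

theorem mid_mem {M : ℕ} (hM : 0 < M) : Real.pi / (2 * M) ∈ Set.Ioo 0 (Real.pi / M) := by
  have hM : (0 : ℝ) < M := by exact_mod_cast hM
  have := Real.pi_pos
  exact ⟨by positivity, div_lt_div_of_pos_left this hM (by linarith)⟩

theorem exp_mid_pow {M : ℕ} (hM : 0 < M) :
    Complex.exp ((2 * (Real.pi / (2 * M)) : ℝ) * Complex.I) ^ M = -1 := by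
  have hM' : (M : ℂ) ≠ 0 := by exact_mod_cast hM.ne'
  rw [← Complex.exp_nat_mul, ← Complex.exp_pi_mul_I]
  congr 1
  push_cast
  field_simp

theorem coset_pot_of_pow_eq_neg {M : ℕ} (hM : 0 < M) {c z : ℂ} (hz : ‖z‖ = 1)
    (h : z ^ M = -c ^ M) :
    ∑ y ∈ rootCoset M c, rieszKernel 1 z y = ENNReal.ofReal (midPot M) := by
  set e := Complex.exp ((2 * (Real.pi / (2 * M)) : ℝ) * Complex.I) with he
  have he0 : e ≠ 0 := Complex.exp_ne_zero _
  have hn : ‖e‖ = 1 := Complex.norm_exp_ofReal_mul_I _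
  have := coset_pot hM (c := c) (w := z / e) (by rw [norm_div, hz, hn, div_one])
    (by rw [div_pow, h, exp_mid_pow hM]; ring) (mid_mem hM)
  rw [← he, div_mul_cancel₀ _ he0, rootPot_mid] at this
  exact this

/-- Points of the coset have infinite potential; elsewhere strict convexity leaves only the
midpoints of the arcs, whose `M`-th power is `-c ^ M`. -/
theorem le_coset_pot {M : ℕ} (hM : 0 < M) {c z : ℂ} (hc : ‖c‖ = 1) (hz : ‖z‖ = 1) :
    ENNReal.ofReal (midPot M) ≤ ∑ y ∈ rootCoset M c, rieszKernel 1 z y ∧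
      (∑ y ∈ rootCoset M c, rieszKernel 1 z y ≤ ENNReal.ofReal (midPot M) →
        z ^ M = -c ^ M) := by
  obtain ⟨w, hw, hwc, x, hx0, hx1, rfl⟩ := exists_coset_rep hM hc hz
  rcases hx0.eq_or_lt with rfl | hx0
  · have htop : ∑ y ∈ rootCoset M c,
        rieszKernel 1 (w * Complex.exp ((2 * (0 : ℝ) : ℝ) * Complex.I)) y = ⊤ := by
      have hmem : w ∈ rootCoset M c := by
        simp only [rootCoset, Multiset.mem_toFinset]
        rwa [Polynomial.mem_nthRoots hM]
      rw [ENNReal.sum_eq_top]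
      exact ⟨w, hmem, by simp [rieszKernel_self]⟩
    rw [htop]
    simp
  · rw [coset_pot hM hw hwc ⟨hx0, hx1⟩]
    refine ⟨ENNReal.ofReal_le_ofReal (midPot_le_rootPot ⟨hx0, hx1⟩), fun h => ?_⟩
    rw [ENNReal.ofReal_le_ofReal_iff (midPot_nonneg M)] at h
    have hx : x = Real.pi / (2 * M) := by
      by_contra hne
      exact absurd (midPot_lt_rootPot hM ⟨hx0, hx1⟩ hne) (not_lt.2 h)
    rw [hx, mul_pow, exp_mid_pow hM, hwc]
    ring

/-! ### Binary structure of greedy sequences -/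

/-- The points `a 0, …, a (k - 1)` lie on the circle and each is chosen greedily. -/
def GreedyUpTo (a : ℕ → ℂ) (k : ℕ) : Prop :=
  (∀ i < k, a i ∈ unitCircle) ∧
    ∀ j, 0 < j → j < k → ∀ z ∈ unitCircle, pot a j (a j) ≤ pot a j z

/-- The value of the `k`-th greedy minimum. -/
def greedyMin : ℕ → ℝ := binRec fun n _ => midPot (2 ^ n)

theorem greedyMin_add {n r : ℕ} (hr : r < 2 ^ n) :
    greedyMin (2 ^ n + r) = midPot (2 ^ n) + greedyMin r := binRec_add _ hr

theorem greedyMin_zero : greedyMin 0 = 0 := binRec_zero _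

theorem greedyMin_nonneg (k : ℕ) : 0 ≤ greedyMin k := by
  induction k using Nat.strong_induction_on with
  | _ k ih =>
    rcases Nat.eq_zero_or_pos k with rfl | hk
    · rw [greedyMin_zero]
    · obtain ⟨n, r, hr, rfl⟩ := exists_two_pow_add hk
      rw [greedyMin_add hr]
      exact add_nonneg (midPot_nonneg _) (ih r (by have : 0 < 2 ^ n := by positivity
                                                   omega))

theorem norm_of_mem {z : ℂ} (h : z ∈ unitCircle) : ‖z‖ = 1 := by
  simpa [unitCircle] using h

theorem pot_add (a : ℕ → ℂ) (M j : ℕ) (z : ℂ) :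
    pot a (M + j) z = pot a M z + pot (fun i => a (M + i)) j z := by
  simp only [pot, Finset.sum_range_add]

theorem pot_eq_top (a : ℕ → ℂ) {i j : ℕ} (hij : i < j) : pot a j (a i) = ⊤ := by
  rw [pot, ENNReal.sum_eq_top]
  exact ⟨i, Finset.mem_range.2 hij, rieszKernel_self _⟩

/-- Strong induction on `k = 2 ^ n + r`, for all sequences at once so that it also applies to the
tail starting at `a (2 ^ n)`. The statement on powers keeps the minimizers for the tail inside the
opposite coset, which is what decouples the two potentials. -/
theorem greedy_structure (k : ℕ) (hk : 0 < k) : ∀ (a : ℕ → ℂ), GreedyUpTo a k →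
    ∀ w ∈ unitCircle, (∀ z ∈ unitCircle, pot a k w ≤ pot a k z) →
      pot a k w = ENNReal.ofReal (greedyMin k) ∧ ∀ m, k < 2 ^ m → w ^ 2 ^ m = a 0 ^ 2 ^ m := by
  induction k using Nat.strong_induction_on with
  | _ k ih =>
  intro a ha w hw hmin
  obtain ⟨n, r, hr, rfl⟩ := exists_two_pow_add hk
  set M := 2 ^ n with hMdef
  have hM : 0 < M := by positivity
  have hc : ‖a 0‖ = 1 := norm_of_mem (ha.1 0 hk)
  -- the first `2 ^ n` points
  have hpre : ∀ j, 0 < j → j < M →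
      pot a j (a j) = ENNReal.ofReal (greedyMin j) ∧ a j ^ M = a 0 ^ M := by
    intro j hj0 hj
    have := ih j (by omega) hj0 a ⟨fun i hi => ha.1 i (by omega),
      fun i h0 hi => ha.2 i h0 (by omega)⟩ (a j) (ha.1 j (by omega)) (ha.2 j hj0 (by omega))
    exact ⟨this.1, this.2 n hj⟩
  have hcoset : ∀ z, pot a M z = ∑ y ∈ rootCoset M (a 0), rieszKernel 1 z y := by
    intro z
    refine sum_rootCoset hM a ?_ ?_ (fun y => rieszKernel 1 z y)
    · intro i hi
      rcases Nat.eq_zero_or_pos i with rfl | h0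
      · rfl
      · exact (hpre i h0 hi).2
    -- A repeated point would have infinite potential, against the finite value from the induction.
    · intro i hi j hj h
      have h1 := (hpre i (by omega) hi).1
      rw [h, pot_eq_top a hj] at h1
      exact ENNReal.ofReal_ne_top h1.symm
  have hlow : ∀ z ∈ unitCircle, ENNReal.ofReal (midPot M) ≤ pot a M z := fun z hz => by
    rw [hcoset]; exact (le_coset_pot hM hc (norm_of_mem hz)).1
  have hval : ∀ z ∈ unitCircle, z ^ M = - a 0 ^ M → pot a M z = ENNReal.ofReal (midPot M) :=
    fun z hz h => by rw [hcoset]; exact coset_pot_of_pow_eq_neg hM (norm_of_mem hz) h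
  have hbase : ∀ z ∈ unitCircle, (∀ y ∈ unitCircle, pot a M z ≤ pot a M y) →
      z ^ M = - a 0 ^ M := by
    intro z hz h
    set e := Complex.exp ((2 * (Real.pi / (2 * M)) : ℝ) * Complex.I) with he
    have hn : ‖e‖ = 1 := Complex.norm_exp_ofReal_mul_I _
    have hmem : a 0 * e ∈ unitCircle := by simp [unitCircle, hc, hn]
    have h1 := hval (a 0 * e) hmem (by rw [mul_pow, exp_mid_pow hM]; ring)
    have h2 := h _ hmem
    rw [h1, hcoset] at h2
    exact (le_coset_pot hM hc (norm_of_mem hz)).2 h2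
  have hfin : ∀ z : ℂ, z ^ M = - a 0 ^ M → ∀ m, M + r < 2 ^ m → z ^ 2 ^ m = a 0 ^ 2 ^ m := by
    intro z hz m hm
    -- Since `m > n`, the exponent `2 ^ m` is an even multiple of `M`, and the sign disappears.
    have hnm : n < m := (Nat.pow_lt_pow_iff_right (a := 2) (by norm_num)).1 (by omega)
    obtain ⟨d, rfl⟩ := Nat.exists_eq_add_of_lt hnm
    have : 2 ^ (n + d + 1) = M * (2 * 2 ^ d) := by rw [hMdef]; ring
    rw [this, pow_mul, hz, pow_mul, pow_mul, neg_sq, pow_mul]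
  rcases Nat.eq_zero_or_pos r with rfl | hr0
  · have h := hbase w hw hmin
    refine ⟨?_, hfin w h⟩
    rw [greedyMin_add hr, greedyMin_zero, add_zero, add_zero]
    exact hval w hw h
  · set b : ℕ → ℂ := fun i => a (M + i) with hb
    have hb0 : b 0 ^ M = - a 0 ^ M :=
      hbase (a M) (ha.1 M (by omega)) (ha.2 M hM (by omega))
    -- A minimizer `z` for the tail lies in the opposite coset, so it also attains the lower bound
    -- `midPot M` for the first `M` points. Comparing `u` with `z` and cancelling this finite bound
    -- shows that `u` is optimal for the tail.
    have key : ∀ j, 0 < j → j ≤ r → GreedyUpTo b j → ∀ u ∈ unitCircle,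
        (∀ z ∈ unitCircle, pot a (M + j) u ≤ pot a (M + j) z) →
        (∀ z ∈ unitCircle, pot b j u ≤ pot b j z) := by
      intro j hj0 hj hg u hu hu'
      obtain ⟨z, hz, hzmin⟩ := exists_minimizer b j
      have hzz := (ih j (by omega) hj0 b hg z hz hzmin).2 n (by omega)
      have h1 := hu' z hz
      rw [pot_add, pot_add, hval z hz (hzz.trans hb0)] at h1
      have h2 : pot b j u ≤ pot b j z := by
        have h3 := (add_le_add_left (hlow u hu) (pot b j u)).trans h1
        exact (ENNReal.add_le_add_iff_left ENNReal.ofReal_ne_top).1 h3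
      exact fun y hy => h2.trans (hzmin y hy)
    have hg : ∀ j, j ≤ r → GreedyUpTo b j := by
      intro j
      induction j with
      | zero => exact fun _ => ⟨fun i hi => absurd hi (by omega), fun i _ hi => absurd hi (by omega)⟩
      | succ j ihj =>
        intro hj
        have hgj := ihj (by omega)
        refine ⟨fun i hi => ha.1 (M + i) (by omega), fun i h0 hi => ?_⟩
        rcases Nat.lt_succ_iff_lt_or_eq.1 hi with hi | rfl
        · exact hgj.2 i h0 hi
        · exact key i h0 (by omega) hgj (a (M + i)) (ha.1 _ (by omega))
            (ha.2 (M + i) (by omega) (by omega))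
    have hwb := key r hr0 le_rfl (hg r le_rfl) w hw hmin
    have hfinal := ih r (by omega) hr0 b (hg r le_rfl) w hw hwb
    have hwM : w ^ M = - a 0 ^ M := (hfinal.2 n hr).trans hb0
    refine ⟨?_, hfin w hwM⟩
    rw [pot_add, hval w hw hwM, hfinal.1, ← ENNReal.ofReal_add (midPot_nonneg _)
      (greedyMin_nonneg _)]
    rw [hMdef, greedyMin_add hr]

/-! ### The energy as a sum of greedy minima -/

theorem energy_succ (a : ℕ → ℂ) (N : ℕ) :
    energy 1 a (N + 1) = energy 1 a N + 2 * pot a N (a N) := by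
  have h1 : (Finset.range (N + 1)).erase N = Finset.range N := by
    rw [Finset.range_add_one, Finset.erase_insert (by simp)]
  rw [energy, Finset.sum_range_succ, h1, energy, two_mul, ← add_assoc, ← pot]
  congr 1
  have h2 : ∀ i ∈ Finset.range N,
      ∑ j ∈ (Finset.range (N + 1)).erase i, rieszKernel 1 (a i) (a j) =
      ∑ j ∈ (Finset.range N).erase i, rieszKernel 1 (a i) (a j) + rieszKernel 1 (a N) (a i) := by
    intro i hi
    have hi := Finset.mem_range.1 hi
    rw [Finset.range_add_one, Finset.erase_insert_of_ne (by omega),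
      Finset.sum_insert (by simp), add_comm, rieszKernel_comm (a N)]
  rw [Finset.sum_congr rfl h2, Finset.sum_add_distrib, pot]

theorem IsGreedySeq.greedyUpTo {a : ℕ → ℂ} (ha : IsGreedySeq 1 a) (k : ℕ) : GreedyUpTo a k := by
  refine ⟨fun i _ => ha.1 i, fun j hj _ z hz => ?_⟩
  obtain ⟨n, rfl⟩ : ∃ n, j = n + 1 := ⟨j - 1, by omega⟩
  rw [pot, ha.2 n]
  exact iInf₂_le z hz

theorem IsGreedySeq.energy_eq {a : ℕ → ℂ} (ha : IsGreedySeq 1 a) (N : ℕ) :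
    energy 1 a N = ENNReal.ofReal (2 * ∑ m ∈ Finset.range N, greedyMin m) := by
  induction N with
  | zero => simp [energy]
  | succ N ih =>
    have hp : pot a N (a N) = ENNReal.ofReal (greedyMin N) := by
      rcases Nat.eq_zero_or_pos N with rfl | hN
      · simp [pot, greedyMin_zero]
      · exact (greedy_structure N hN a (ha.greedyUpTo N) (a N) (ha.1 N)
          ((ha.greedyUpTo (N + 1)).2 N hN (by omega))).1
    have h2 : (2 : ENNReal) = ENNReal.ofReal 2 := by simp
    rw [energy_succ, ih, hp, Finset.sum_range_succ, mul_add, ENNReal.ofReal_add _ _,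
      ENNReal.ofReal_mul (p := 2) (q := greedyMin N) (by norm_num), ← h2]
    · exact mul_nonneg (by norm_num) (Finset.sum_nonneg fun i _ => greedyMin_nonneg i)
    · exact mul_nonneg (by norm_num) (greedyMin_nonneg N)

/-! ### Asymptotics of the energy of roots of unity -/

/-- The sum of the reciprocal distances from one `M`-th root of unity to the others. -/
def rootSum (M : ℕ) : ℝ := ∑ k ∈ Finset.range M, 1 / (2 * Real.sin (Real.pi * k / M))

theorem sum_range_two_mul (f : ℕ → ℝ) (M : ℕ) :
    ∑ k ∈ Finset.range (2 * M), f k =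
      ∑ k ∈ Finset.range M, f (2 * k) + ∑ k ∈ Finset.range M, f (2 * k + 1) := by
  induction M with
  | zero => simp
  | succ M ih =>
    rw [show 2 * (M + 1) = 2 * M + 1 + 1 by ring, Finset.sum_range_succ, Finset.sum_range_succ,
      ih, Finset.sum_range_succ, Finset.sum_range_succ]
    ring

/-- Among the `2M`-th roots the even indices are the `M`-th roots and the odd ones the midpoints of
the arcs. The term `k = 0` is `1 / 0 = 0`, so the self-interaction drops out on both sides. -/
theorem rootSum_two_mul {M : ℕ} (hM : 0 < M) : rootSum (2 * M) = rootSum M + midPot M := by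
  have hM : (M : ℝ) ≠ 0 := by exact_mod_cast hM.ne'
  rw [rootSum, sum_range_two_mul, rootSum, midPot]
  congr 1 <;> refine Finset.sum_congr rfl fun k _ => ?_ <;> congr 3 <;> push_cast <;> field_simp
  ring

/-- Reflection in `π / 2` folds the sum; the term at `π / 2` is then counted twice, whence the `1 /
2`. -/
theorem rootSum_even {m : ℕ} (hm : 0 < m) :
    rootSum (2 * m) =
      ∑ k ∈ Finset.range m, 1 / Real.sin (Real.pi / (2 * m) * (k + 1 : ℕ)) - 1 / 2 := by
  have hm' : (m : ℝ) ≠ 0 := by exact_mod_cast hm.ne'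
  set f : ℕ → ℝ := fun k => 1 / Real.sin (Real.pi / (2 * m) * k) with hf
  have h1 : rootSum (2 * m) = (∑ k ∈ Finset.range (m + m), f k) / 2 := by
    rw [rootSum, Finset.sum_div, two_mul]
    refine Finset.sum_congr rfl fun k _ => ?_
    rw [hf, div_div, mul_comm]
    congr 3
    push_cast
    field_simp
    ring
  have h2 : ∑ k ∈ Finset.range m, f (m + k) = ∑ k ∈ Finset.range m, f (k + 1) := by
    rw [← Finset.sum_range_reflect]
    refine Finset.sum_congr rfl fun k hk => ?_
    have hk' : k + 1 ≤ m := Finset.mem_range.1 hk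
    simp only [hf]
    rw [← Real.sin_pi_sub]
    congr 2
    rw [show m + (m - 1 - k) = 2 * m - (k + 1) by omega, Nat.cast_sub (by omega)]
    push_cast
    field_simp
    ring
  have h3 : ∑ k ∈ Finset.range m, f k = ∑ k ∈ Finset.range m, f (k + 1) - 1 := by
    have h := Finset.sum_range_succ f m
    rw [Finset.sum_range_succ'] at h
    have h0 : f 0 = 0 := by simp [hf]
    have hmm : f m = 1 := by
      simp only [hf]
      rw [show Real.pi / (2 * m) * m = Real.pi / 2 by field_simp]
      simp
    linarith
  rw [h1, Finset.sum_range_add, h2, h3]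
  ring

/-- The regular part of the cosecant. -/
def cscReg (x : ℝ) : ℝ := 1 / Real.sin x - 1 / x

/-- A primitive of `cscReg`. -/
def cscPrim (x : ℝ) : ℝ := Real.log (Real.sin (x / 2)) - Real.log (Real.cos (x / 2)) - Real.log x

theorem hasDerivAt_cscPrim {x : ℝ} (h0 : 0 < x) (h1 : x ≤ Real.pi / 2) :
    HasDerivAt cscPrim (cscReg x) x := by
  have hpi := Real.pi_pos
  have hs : 0 < Real.sin (x / 2) := Real.sin_pos_of_pos_of_lt_pi (by linarith) (by linarith)
  have hc : 0 < Real.cos (x / 2) := Real.cos_pos_of_mem_Ioo ⟨by linarith, by linarith⟩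
  have hd : HasDerivAt (fun x : ℝ => x / 2) (1 / 2) x := (hasDerivAt_id x).div_const 2
  refine (((hd.sin.log hs.ne').sub (hd.cos.log hc.ne')).sub
    (Real.hasDerivAt_log h0.ne')).congr_deriv ?_
  rw [cscReg]
  have h2 : Real.sin x = 2 * Real.sin (x / 2) * Real.cos (x / 2) := by
    rw [← Real.sin_two_mul]; congr 1; ring
  rw [h2, one_div x]
  congr 1
  have := Real.sin_sq_add_cos_sq (x / 2)
  field_simp
  linarith

/-- This is the sign of the derivative of `cscReg`. It follows from `x / 2 ≤ tan (x / 2)` and `2 c ^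
2 - 1 ≤ c ^ 4` with `c = cos (x / 2)`. -/
theorem sq_mul_cos_le {x : ℝ} (h0 : 0 < x) (h1 : x < Real.pi / 2) :
    x ^ 2 * Real.cos x ≤ Real.sin x ^ 2 := by
  have hpi := Real.pi_pos
  have hc : 0 < Real.cos (x / 2) := Real.cos_pos_of_mem_Ioo ⟨by linarith, by linarith⟩
  have hcx : 0 < Real.cos x := Real.cos_pos_of_mem_Ioo ⟨by linarith, by linarith⟩
  have ht := Real.le_tan (x := x / 2) (by linarith) (by linarith)
  rw [Real.tan_eq_sin_div_cos, le_div_iff₀ hc] at ht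
  have h2 : Real.sin x = 2 * Real.sin (x / 2) * Real.cos (x / 2) := by
    rw [← Real.sin_two_mul]; congr 1; ring
  have h3 : Real.cos x = 2 * Real.cos (x / 2) ^ 2 - 1 := by
    rw [← Real.cos_two_mul]; congr 1; ring
  have h4 : Real.cos x ≤ Real.cos (x / 2) ^ 4 := by
    rw [h3]; nlinarith [sq_nonneg (Real.cos (x / 2) ^ 2 - 1)]
  have h5 : (x * Real.cos (x / 2)) ^ 2 ≤ (2 * Real.sin (x / 2)) ^ 2 :=
    pow_le_pow_left₀ (by positivity) (by linarith) 2
  rw [h2]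
  calc x ^ 2 * Real.cos x ≤ x ^ 2 * Real.cos (x / 2) ^ 4 :=
        mul_le_mul_of_nonneg_left h4 (sq_nonneg x)
    _ = (x * Real.cos (x / 2)) ^ 2 * Real.cos (x / 2) ^ 2 := by ring
    _ ≤ (2 * Real.sin (x / 2)) ^ 2 * Real.cos (x / 2) ^ 2 :=
        mul_le_mul_of_nonneg_right h5 (sq_nonneg _)
    _ = _ := by ring

theorem monotoneOn_cscReg : MonotoneOn cscReg (Set.Ioc 0 (Real.pi / 2)) := by
  have hpi := Real.pi_pos
  have hd : ∀ x ∈ Set.Ioc 0 (Real.pi / 2),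
      HasDerivAt cscReg (-Real.cos x / Real.sin x ^ 2 - -(x ^ 2)⁻¹) x := by
    intro x hx
    have hs : 0 < Real.sin x :=
      Real.sin_pos_of_pos_of_lt_pi hx.1 (by linarith [hx.2])
    have h := ((Real.hasDerivAt_sin x).inv hs.ne').sub (hasDerivAt_inv hx.1.ne')
    unfold cscReg
    simp only [one_div]
    exact h
  refine monotoneOn_of_deriv_nonneg (convex_Ioc _ _)
    (fun x hx => (hd x hx).continuousAt.continuousWithinAt) ?_ ?_
  · rw [interior_Ioc]
    exact fun x hx => (hd x ⟨hx.1, hx.2.le⟩).differentiableAt.differentiableWithinAt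
  · rw [interior_Ioc]
    intro x hx
    have hs : 0 < Real.sin x :=
      Real.sin_pos_of_pos_of_lt_pi hx.1 (by linarith [hx.2])
    have hx0 := hx.1
    rw [(hd x ⟨hx.1, hx.2.le⟩).deriv, neg_div, sub_neg_eq_add, neg_add_eq_sub, sub_nonneg,
      inv_eq_one_div, div_le_div_iff₀ (by positivity) (by positivity)]
    linarith [sq_mul_cos_le hx.1 hx.2]

theorem abs_cscPrim_sub_le {x y : ℝ} (hx : 0 < x) (hxy : x < y) (hy : y ≤ Real.pi / 2) :
    |cscPrim y - cscPrim x - (y - x) * cscReg x| ≤ (y - x) * (cscReg y - cscReg x) := by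
  obtain ⟨c, hc, h⟩ := exists_hasDerivAt_eq_slope cscPrim cscReg hxy
    (fun z hz => (hasDerivAt_cscPrim (by linarith [hz.1]) (by linarith [hz.2])).continuousAt.continuousWithinAt)
    (fun z hz => hasDerivAt_cscPrim (by linarith [hz.1]) (by linarith [hz.2]))
  rw [eq_div_iff (by linarith)] at h
  have h1 := monotoneOn_cscReg ⟨hx, by linarith⟩ ⟨by linarith [hc.1], by linarith [hc.2]⟩ hc.1.le
  have h2 := monotoneOn_cscReg ⟨by linarith [hc.1], by linarith [hc.2]⟩ ⟨by linarith, hy⟩ hc.2.le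
  rw [← h, abs_of_nonneg] <;> nlinarith

/-- For a monotone integrand the errors of a Riemann sum telescope to the mesh times the total
increment. -/
theorem abs_cscReg_sum_le {h : ℝ} (hh : 0 < h) (j : ℕ) (hj : h * (j + 1 : ℕ) ≤ Real.pi / 2) :
    |cscPrim (h * (j + 1 : ℕ)) - cscPrim h - h * ∑ k ∈ Finset.range j, cscReg (h * (k + 1 : ℕ))|
      ≤ h * (cscReg (h * (j + 1 : ℕ)) - cscReg h) := by
  induction j with
  | zero => simp
  | succ j ih =>
    have hlt : h * (j + 1 : ℕ) < h * (j + 1 + 1 : ℕ) := by push_cast; nlinarith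
    have h1 := ih (by linarith)
    have h2 := abs_cscPrim_sub_le (by positivity) hlt hj
    have h3 : h * (j + 1 + 1 : ℕ) - h * (j + 1 : ℕ) = h := by push_cast; ring
    rw [h3] at h2
    rw [Finset.sum_range_succ]
    rw [abs_le] at *
    constructor <;> nlinarith [h1.1, h1.2, h2.1, h2.2]

theorem tendsto_cscPrim : Tendsto cscPrim (𝓝[>] 0) (𝓝 (-Real.log 2)) := by
  have h1 : Tendsto (fun x : ℝ => Real.sin (x / 2) / x) (𝓝[>] 0) (𝓝 (1 / 2)) := by
    have hd : HasDerivAt (fun x : ℝ => x / 2) (1 / 2) 0 := (hasDerivAt_id 0).div_const 2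
    have := hd.sin.tendsto_slope_zero_right
    simpa [div_eq_inv_mul] using this
  have h2 : Tendsto (fun x : ℝ => Real.log (Real.cos (x / 2))) (𝓝[>] 0) (𝓝 0) := by
    have : ContinuousAt (fun x : ℝ => Real.log (Real.cos (x / 2))) 0 := by
      refine ContinuousAt.log (by fun_prop) (by simp)
    have := this.tendsto
    simp only [zero_div, Real.cos_zero, Real.log_one] at this
    exact this.mono_left nhdsWithin_le_nhds
  have h3 := (h1.log (by norm_num)).sub h2
  have h4 : Real.log (1 / 2) - 0 = - Real.log 2 := by simp
  rw [h4] at h3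
  refine h3.congr' ?_
  have : Set.Ioo (0 : ℝ) 1 ∈ 𝓝[>] (0 : ℝ) := Ioo_mem_nhdsGT one_pos
  filter_upwards [this] with x hx
  have hs : 0 < Real.sin (x / 2) :=
    Real.sin_pos_of_pos_of_lt_pi (by linarith [hx.1]) (by linarith [hx.2, Real.pi_gt_three])
  rw [Real.log_div hs.ne' hx.1.ne', cscPrim]
  ring

theorem cscPrim_pi_div_two : cscPrim (Real.pi / 2) = -Real.log (Real.pi / 2) := by
  have : Real.pi / 2 / 2 = Real.pi / 4 := by ring
  rw [cscPrim, this, Real.sin_pi_div_four, Real.cos_pi_div_four]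
  ring

/-- The constant in the second order term of the energy of roots of unity. -/
def rootConst : ℝ := Real.eulerMascheroniConstant - Real.log (Real.pi / 2)

/-- The part `1 / x` of the cosecant gives a harmonic sum, hence `log m + γ`; the regular part gives
a Riemann sum tending to `cscPrim (π / 2) - cscPrim 0⁺ = log 2 - log (π / 2)`. -/
theorem tendsto_rootSum :
    Tendsto (fun m : ℕ => Real.pi / (2 * m) * rootSum (2 * m) - Real.log (2 * m)) atTop
      (𝓝 rootConst) := by
  have hpi := Real.pi_pos
  have hh : Tendsto (fun m : ℕ => Real.pi / (2 * (m : ℝ))) atTop (𝓝 0) := by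
    have := (tendsto_const_nhds (x := Real.pi / 2)).div_atTop
      (tendsto_natCast_atTop_atTop (R := ℝ))
    simpa [div_div] using this
  have hh' : Tendsto (fun m : ℕ => Real.pi / (2 * (m : ℝ))) atTop (𝓝[>] 0) := by
    refine tendsto_nhdsWithin_iff.2 ⟨hh, ?_⟩
    filter_upwards [eventually_gt_atTop 0] with m hm
    have : (0 : ℝ) < m := by exact_mod_cast hm
    exact Set.mem_Ioi.2 (by positivity)
  -- the Riemann sums of the regular part
  have hR : Tendsto (fun m : ℕ => Real.pi / (2 * m) *
      ∑ k ∈ Finset.range m, cscReg (Real.pi / (2 * m) * (k + 1 : ℕ))) atTop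
      (𝓝 (-Real.log (Real.pi / 2) + Real.log 2)) := by
    have hmain : Tendsto (fun m : ℕ => cscPrim (Real.pi / 2) - cscPrim (Real.pi / (2 * m)))
        atTop (𝓝 (-Real.log (Real.pi / 2) + Real.log 2)) := by
      have := (tendsto_const_nhds (x := cscPrim (Real.pi / 2))).sub (tendsto_cscPrim.comp hh')
      simpa [cscPrim_pi_div_two] using this
    have hdiff : Tendsto (fun m : ℕ => Real.pi / (2 * m) *
      ∑ k ∈ Finset.range m, cscReg (Real.pi / (2 * m) * (k + 1 : ℕ)) -
        (cscPrim (Real.pi / 2) - cscPrim (Real.pi / (2 * m)))) atTop (𝓝 0) := by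
      -- One mesh width bounds the Riemann sum error and another the extra term at `π / 2`, because
      -- `cscReg (π / 2) ≤ 1`.
      have hb := hh.mul_const 2
      rw [zero_mul] at hb
      refine squeeze_zero_norm' ?_ hb
      filter_upwards [eventually_gt_atTop 0] with m hm
      obtain ⟨j, rfl⟩ : ∃ j, m = j + 1 := ⟨m - 1, by omega⟩
      have hm' : (0 : ℝ) < (j + 1 : ℕ) := by exact_mod_cast hm
      set h := Real.pi / (2 * ((j + 1 : ℕ) : ℝ)) with hdef
      have hpos : 0 < h := by positivity
      have hend : h * (j + 1 : ℕ) = Real.pi / 2 := by rw [hdef]; field_simp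
      have := abs_cscReg_sum_le hpos j hend.le
      rw [hend] at this
      have hle : h ≤ Real.pi / 2 := by
        rw [← hend]
        have : (1 : ℝ) ≤ (j + 1 : ℕ) := by exact_mod_cast hm
        nlinarith
      have hend1 : cscReg (Real.pi / 2) ≤ 1 := by
        rw [cscReg, Real.sin_pi_div_two]
        have : 0 < 1 / (Real.pi / 2) := by positivity
        linarith
      have hmono := monotoneOn_cscReg ⟨hpos, hle⟩ ⟨by positivity, le_rfl⟩ hle
      have hnn : 0 ≤ cscReg h := by
        rw [cscReg, sub_nonneg]
        exact one_div_le_one_div_of_le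
          (Real.sin_pos_of_pos_of_lt_pi hpos (by linarith)) (Real.sin_le hpos.le)
      rw [Finset.sum_range_succ, hend, Real.norm_eq_abs]
      have h5 : h * cscReg (Real.pi / 2) ≤ h * 1 := mul_le_mul_of_nonneg_left hend1 hpos.le
      have h6 : 0 ≤ h * cscReg h := by positivity
      have h7 : 0 ≤ h * cscReg (Real.pi / 2) := by
        exact mul_nonneg hpos.le (by linarith)
      rw [mul_sub] at this
      rw [mul_add]
      rw [abs_le] at *
      constructor <;> linarith [this.1, this.2]
    have := hdiff.add hmain
    simpa using this
  have hlim := ((hR.add Real.tendsto_harmonic_sub_log).sub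
    (hh.mul_const (1 / 2))).sub_const (Real.log 2)
  have hc : -Real.log (Real.pi / 2) + Real.log 2 + Real.eulerMascheroniConstant - 0 * (1 / 2) -
      Real.log 2 = rootConst := by rw [rootConst]; ring
  rw [hc] at hlim
  refine hlim.congr' ?_
  filter_upwards [eventually_gt_atTop 0] with m hm
  have hm' : (0 : ℝ) < m := by exact_mod_cast hm
  rw [rootSum_even hm, Real.log_mul (by norm_num) hm'.ne', mul_sub, mul_comm _ (1 / 2 : ℝ)]
  have : Real.pi / (2 * m) *
      ∑ k ∈ Finset.range m, 1 / Real.sin (Real.pi / (2 * m) * (k + 1 : ℕ)) =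
      Real.pi / (2 * m) * ∑ k ∈ Finset.range m, cscReg (Real.pi / (2 * m) * (k + 1 : ℕ)) +
        harmonic m := by
    simp only [cscReg, harmonic]
    rw [Finset.sum_sub_distrib, mul_sub]
    push_cast
    rw [Finset.mul_sum (f := fun k : ℕ => 1 / (Real.pi / (2 * (m : ℝ)) * ((k : ℝ) + 1)))]
    rw [sub_add, eq_comm, sub_eq_self, sub_eq_zero]
    refine Finset.sum_congr rfl fun k _ => ?_
    have : (k : ℝ) + 1 ≠ 0 := by positivity
    field_simp
  rw [this]
  ring

/-! ### Main term and error of the greedy energy -/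

theorem sum_greedyMin_add (n r : ℕ) (hr : r ≤ 2 ^ n) :
    ∑ m ∈ Finset.range (2 ^ n + r), greedyMin m = ∑ m ∈ Finset.range (2 ^ n), greedyMin m +
      r * midPot (2 ^ n) + ∑ m ∈ Finset.range r, greedyMin m := by
  rw [Finset.sum_range_add, add_assoc]
  congr 1
  rw [Finset.sum_congr rfl fun i hi =>
    greedyMin_add (lt_of_lt_of_le (Finset.mem_range.1 hi) hr)]
  rw [Finset.sum_add_distrib]
  simp

theorem two_mul_sum_greedyMin (n : ℕ) :
    2 * ∑ m ∈ Finset.range (2 ^ n), greedyMin m = 2 ^ n * rootSum (2 ^ n) := by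
  induction n with
  | zero => simp [greedyMin_zero, rootSum]
  | succ n ih =>
    rw [pow_succ, mul_two, sum_greedyMin_add n _ le_rfl, ← two_mul (2 ^ n : ℕ),
      rootSum_two_mul (by positivity)]
    push_cast
    rw [pow_succ]
    linear_combination 2 * ih

/-- The main term of the energy without the quadratic one. -/
def logMain : ℕ → ℝ := binRec fun n r =>
  (2 ^ n) ^ 2 * Real.log (2 ^ n) + 2 * r * 2 ^ n * (Real.log (2 ^ n) + 2 * Real.log 2)

theorem logMain_zero : logMain 0 = 0 := binRec_zero _

theorem logMain_add {n r : ℕ} (hr : r < 2 ^ n) :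
    logMain (2 ^ n + r) = (2 ^ n) ^ 2 * Real.log (2 ^ n) +
      2 * r * 2 ^ n * (Real.log (2 ^ n) + 2 * Real.log 2) + logMain r := binRec_add _ hr

theorem logMain_two_pow (n : ℕ) : logMain (2 ^ n) = (2 ^ n) ^ 2 * Real.log (2 ^ n) := by
  have := logMain_add (n := n) (r := 0) (by positivity)
  simpa [logMain_zero] using this

/-- The error term of the energy of `N` greedy points. -/
def energyErr (N : ℕ) : ℝ :=
  2 * ∑ m ∈ Finset.range N, greedyMin m - (logMain N + rootConst * (N : ℝ) ^ 2) / Real.pi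

/-- The relative error term of the energy of roots of unity. -/
def rootErr (n : ℕ) : ℝ :=
  rootSum (2 ^ n) / 2 ^ n - (Real.log (2 ^ n) + rootConst) / Real.pi

theorem tendsto_rootErr : Tendsto rootErr atTop (𝓝 0) := by
  -- The asymptotics are known only for even orders, which excludes `2 ^ 0`.
  rw [← tendsto_add_atTop_iff_nat 1]
  have h := tendsto_rootSum.comp (tendsto_pow_atTop_atTop_of_one_lt (one_lt_two (α := ℕ)))
  have h2 := (h.sub_const rootConst).div_const Real.pi
  rw [sub_self, zero_div] at h2
  refine h2.congr fun n => ?_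
  have hpi := Real.pi_ne_zero
  simp only [Function.comp, rootErr]
  rw [pow_succ', pow_succ']
  push_cast
  field_simp
  ring

theorem energyErr_two_pow (n : ℕ) : energyErr (2 ^ n) = (2 ^ n) ^ 2 * rootErr n := by
  have hpi := Real.pi_ne_zero
  rw [energyErr, two_mul_sum_greedyMin, logMain_two_pow, rootErr]
  push_cast
  field_simp

/-- With `M = 2 ^ n`, the combination of root errors comes from `midPot M = rootSum (2 * M) -
rootSum M`; the constant cancels since `M ^ 2 + 2 r M + r ^ 2 = (M + r) ^ 2`. -/
theorem energyErr_add {n r : ℕ} (hr : r < 2 ^ n) :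
    energyErr (2 ^ n + r) = (2 ^ n) ^ 2 * rootErr n +
      2 * r * 2 ^ n * (2 * rootErr (n + 1) - rootErr n) + energyErr r := by
  have hpi := Real.pi_ne_zero
  rw [← energyErr_two_pow, energyErr, energyErr, energyErr, sum_greedyMin_add n r hr.le,
    logMain_add hr, logMain_two_pow, rootErr, rootErr]
  have h1 := rootSum_two_mul (M := 2 ^ n) (by positivity)
  rw [pow_succ' 2 n, pow_succ' 2 n, h1, Real.log_mul (by norm_num) (by positivity)]
  push_cast
  field_simp
  ring

/-- The weights in `energyErr_add` and the bound for `r` add up to `(2 ^ n + r) ^ 2`, so `ε N ^ 2`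
reproduces itself; `A` absorbs the finitely many small `N`. -/
theorem exists_energyErr_bound {ε : ℝ} (hε : 0 < ε) :
    ∃ A, ∀ N : ℕ, |energyErr N| ≤ ε * (N : ℝ) ^ 2 + A := by
  have h1 : ∀ᶠ n in atTop, |rootErr n| ≤ ε := by
    have := tendsto_rootErr.abs.eventually_le_const (u := ε) (by simpa using hε)
    exact this
  have h2 : ∀ᶠ n in atTop, |2 * rootErr (n + 1) - rootErr n| ≤ ε := by
    have h := (((tendsto_add_atTop_iff_nat 1).2 tendsto_rootErr).const_mul 2).sub tendsto_rootErr
    exact h.abs.eventually_le_const (u := ε) (by simpa using hε)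
  obtain ⟨n₀, hn₀⟩ := eventually_atTop.1 (h1.and h2)
  refine ⟨∑ m ∈ Finset.range (2 ^ n₀), |energyErr m|, fun N => ?_⟩
  induction N using Nat.strong_induction_on with
  | _ N ih =>
    by_cases hN : N < 2 ^ n₀
    · have : |energyErr N| ≤ ∑ m ∈ Finset.range (2 ^ n₀), |energyErr m| :=
        Finset.single_le_sum (f := fun m => |energyErr m|) (fun _ _ => abs_nonneg _)
          (Finset.mem_range.2 hN)
      have h0 : 0 ≤ ε * (N : ℝ) ^ 2 := by positivity
      linarith
    · have hp : 0 < 2 ^ n₀ := by positivity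
      obtain ⟨n, r, hr, rfl⟩ := exists_two_pow_add (k := N) (by omega)
      have hn : n₀ ≤ n := by
        by_contra h
        have : 2 ^ (n + 1) ≤ 2 ^ n₀ := Nat.pow_le_pow_right (by norm_num) (by omega)
        rw [pow_succ] at this
        omega
      have h3 := ih r (by have : 0 < 2 ^ n := by positivity
                          omega)
      rw [energyErr_add hr]
      have h4 : |((2 : ℝ) ^ n) ^ 2 * rootErr n| ≤ (2 ^ n) ^ 2 * ε := by
        rw [abs_mul, abs_of_nonneg (by positivity)]
        exact mul_le_mul_of_nonneg_left (hn₀ n hn).1 (by positivity)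
      have h5 : |2 * (r : ℝ) * 2 ^ n * (2 * rootErr (n + 1) - rootErr n)| ≤
          2 * r * 2 ^ n * ε := by
        rw [abs_mul, abs_of_nonneg (a := 2 * (r : ℝ) * 2 ^ n) (by positivity)]
        exact mul_le_mul_of_nonneg_left (hn₀ n hn).2 (by positivity)
      refine (abs_add_le _ _).trans ((add_le_add (abs_add_le _ _) le_rfl).trans ?_)
      push_cast
      linarith

theorem tendsto_energyErr : Tendsto (fun N : ℕ => energyErr N / (N : ℝ) ^ 2) atTop (𝓝 0) := by
  rw [Metric.tendsto_atTop']
  intro ε hε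
  obtain ⟨A, hA⟩ := exists_energyErr_bound (half_pos hε)
  have hlim : Tendsto (fun N : ℕ => A / (N : ℝ) ^ 2) atTop (𝓝 0) :=
    tendsto_const_nhds.div_atTop
      ((tendsto_pow_atTop two_ne_zero).comp tendsto_natCast_atTop_atTop)
  obtain ⟨n, hn⟩ := eventually_atTop.1 (hlim.eventually_lt_const (half_pos hε))
  refine ⟨n, fun N hN => ?_⟩
  have hN0 : (0 : ℝ) < N := by exact_mod_cast (by omega : 0 < N)
  have h1 := hn N hN.le
  rw [div_lt_iff₀ (by positivity)] at h1
  rw [Real.dist_eq, sub_zero, abs_div, abs_of_nonneg (a := (N : ℝ) ^ 2) (by positivity),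
    div_lt_iff₀ (by positivity)]
  linarith [hA N]

/-! ### Bounds for the oscillating part -/

/-- The oscillating part of the second order coefficient of the energy of `N` greedy points. -/
def osc (N : ℕ) : ℝ := logMain N / (N : ℝ) ^ 2 - Real.log N

theorem IsGreedySeq.normalizedEnergy_eq {a : ℕ → ℂ} (ha : IsGreedySeq 1 a) {N : ℕ} (hN : 0 < N) :
    normalizedEnergy a N = 1 / Real.pi * (rootConst + osc N) + energyErr N / (N : ℝ) ^ 2 := by
  have hN' : (N : ℝ) ≠ 0 := by exact_mod_cast hN.ne'
  have hpi := Real.pi_ne_zero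
  rw [normalizedEnergy, ha.energy_eq, ENNReal.toReal_ofReal, energyErr, osc]
  · field_simp
    ring
  · exact mul_nonneg (by norm_num) (Finset.sum_nonneg fun i _ => greedyMin_nonneg i)

/-- The function is concave on `[0, 1]`, with second derivative `2 (log x - log (1 + x))`, and
vanishes at both ends. -/
theorem entropy_ineq_unit {x : ℝ} (hx : x ∈ Set.Icc (0 : ℝ) 1) :
    0 ≤ 4 * x * Real.log 2 + x ^ 2 * Real.log x - (1 + x) ^ 2 * Real.log (1 + x) := by
  set f : ℝ → ℝ := fun x =>
    4 * x * Real.log 2 + x ^ 2 * Real.log x - (1 + x) ^ 2 * Real.log (1 + x) with hf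
  have hcont : ContinuousOn f (Set.Icc 0 1) := by
    have h1 : Continuous fun x : ℝ => x * (x * Real.log x) :=
      continuous_id.mul Real.continuous_mul_log
    have h2 : ContinuousOn (fun x : ℝ => (1 + x) ^ 2 * Real.log (1 + x)) (Set.Icc 0 1) := by
      refine ContinuousOn.mul (by fun_prop) (ContinuousOn.log (by fun_prop) ?_)
      intro x hx
      have := hx.1
      positivity
    have h3 : ContinuousOn (fun x : ℝ => 4 * x * Real.log 2 + x * (x * Real.log x)) (Set.Icc 0 1) :=
      (by fun_prop : Continuous fun x : ℝ => 4 * x * Real.log 2).continuousOn.add h1.continuousOn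
    refine (h3.sub h2).congr fun x _ => ?_
    simp only [hf, Pi.sub_apply]
    ring
  have hd1 : ∀ x ∈ Set.Ioo (0 : ℝ) 1, HasDerivAt f
      (4 * Real.log 2 - 1 + 2 * (x * Real.log x - (1 + x) * Real.log (1 + x))) x := by
    intro x hx
    have hx0 := hx.1
    have hx1 : 0 < 1 + x := by linarith
    have e : HasDerivAt (fun x : ℝ => 1 + x) 1 x := (hasDerivAt_id x).const_add 1
    have := ((((hasDerivAt_id x).const_mul 4).mul_const (Real.log 2)).add
      (((hasDerivAt_id x).pow 2).mul (Real.hasDerivAt_log hx0.ne'))).sub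
      ((e.pow 2).mul (e.log hx1.ne'))
    refine this.congr_deriv ?_
    simp only [id, Pi.pow_apply]
    field_simp
    ring
  have hd2 : ∀ x ∈ Set.Ioo (0 : ℝ) 1, HasDerivAt
      (fun x => 4 * Real.log 2 - 1 + 2 * (x * Real.log x - (1 + x) * Real.log (1 + x)))
      (2 * (Real.log x - Real.log (1 + x))) x := by
    intro x hx
    have hx0 := hx.1
    have hx1 : 0 < 1 + x := by linarith
    have e : HasDerivAt (fun x : ℝ => 1 + x) 1 x := (hasDerivAt_id x).const_add 1
    have := ((((hasDerivAt_id x).mul (Real.hasDerivAt_log hx0.ne')).sub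
      (e.mul (e.log hx1.ne'))).const_mul 2).const_add (4 * Real.log 2 - 1)
    refine this.congr_deriv ?_
    simp only [id]
    field_simp
    ring
  have hconc : ConcaveOn ℝ (Set.Icc 0 1) f := by
    refine concaveOn_of_hasDerivWithinAt2_nonpos (convex_Icc 0 1) hcont
      (f' := fun x => 4 * Real.log 2 - 1 + 2 * (x * Real.log x - (1 + x) * Real.log (1 + x)))
      (f'' := fun x => 2 * (Real.log x - Real.log (1 + x))) ?_ ?_ ?_ <;> rw [interior_Icc]
    · exact fun x hx => (hd1 x hx).hasDerivWithinAt
    · exact fun x hx => (hd2 x hx).hasDerivWithinAt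
    · intro x hx
      have := Real.log_le_log hx.1 (by linarith : x ≤ 1 + x)
      linarith
  have h := hconc.2 (Set.left_mem_Icc.2 zero_le_one) (Set.right_mem_Icc.2 zero_le_one)
    (sub_nonneg.2 hx.2) hx.1 (sub_add_cancel 1 x)
  have h0 : f 0 = 0 := by simp [hf]
  have h1 : f 1 = 0 := by
    simp only [hf]
    norm_num
  have h' : 0 ≤ f x := by simpa [h0, h1] using h
  exact h'

theorem entropy_ineq {M r : ℝ} (hM : 0 < M) (hr : 0 ≤ r) (hrM : r ≤ M) :
    (M + r) ^ 2 * Real.log (M + r) ≤ M ^ 2 * Real.log M +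
      2 * r * M * (Real.log M + 2 * Real.log 2) + r ^ 2 * Real.log r := by
  rcases hr.eq_or_lt with rfl | hr
  · simp
  have h := entropy_ineq_unit (x := r / M) ⟨by positivity, (div_le_one hM).2 hrM⟩
  have h1 : 1 + r / M = (M + r) / M := by field_simp
  rw [h1, Real.log_div hr.ne' hM.ne', Real.log_div (by positivity) hM.ne'] at h
  have h2 := mul_nonneg (sq_nonneg M) h
  have h3 : M ^ 2 * (4 * (r / M) * Real.log 2 + (r / M) ^ 2 * (Real.log r - Real.log M) -
      ((M + r) / M) ^ 2 * (Real.log (M + r) - Real.log M)) =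
      4 * r * M * Real.log 2 + r ^ 2 * (Real.log r - Real.log M) -
        (M + r) ^ 2 * (Real.log (M + r) - Real.log M) := by
    field_simp
  rw [h3] at h2
  linarith

theorem le_logMain (N : ℕ) : (N : ℝ) ^ 2 * Real.log N ≤ logMain N := by
  induction N using Nat.strong_induction_on with
  | _ N ih =>
    rcases Nat.eq_zero_or_pos N with rfl | hN
    · simp [logMain_zero]
    obtain ⟨n, r, hr, rfl⟩ := exists_two_pow_add hN
    have h1 := ih r (by have : 0 < 2 ^ n := by positivity
                        omega)
    have h2 := entropy_ineq (M := 2 ^ n) (r := r) (by positivity) (by positivity)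
      (by exact_mod_cast hr.le)
    rw [logMain_add hr]
    push_cast
    linarith

/-- Every logarithm is replaced by `log N + 2 log 2`, and the coefficients sum to `N ^ 2`. -/
theorem logMain_le (N : ℕ) : logMain N ≤ (N : ℝ) ^ 2 * (Real.log N + 2 * Real.log 2) := by
  induction N using Nat.strong_induction_on with
  | _ N ih =>
    rcases Nat.eq_zero_or_pos N with rfl | hN
    · simp [logMain_zero]
    obtain ⟨n, r, hr, rfl⟩ := exists_two_pow_add hN
    have h1 := ih r (by have : 0 < 2 ^ n := by positivity
                        omega)
    rw [logMain_add hr]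
    push_cast
    have hp : (0 : ℝ) < 2 ^ n := by positivity
    have hl2 : 0 < Real.log 2 := Real.log_pos (by norm_num)
    have h2 : Real.log (2 ^ n) ≤ Real.log (2 ^ n + r) :=
      Real.log_le_log hp (by linarith [(Nat.cast_nonneg r : (0 : ℝ) ≤ r)])
    have h3 : (r : ℝ) ^ 2 * (Real.log r + 2 * Real.log 2) ≤
        (r : ℝ) ^ 2 * (Real.log (2 ^ n + r) + 2 * Real.log 2) := by
      rcases Nat.eq_zero_or_pos r with rfl | hr0
      · simp
      · have hr0 : (0 : ℝ) < r := by exact_mod_cast hr0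
        have := Real.log_le_log hr0 (by linarith : (r : ℝ) ≤ 2 ^ n + r)
        exact mul_le_mul_of_nonneg_left (by linarith) (sq_nonneg _)
    have h4 : ((2 : ℝ) ^ n) ^ 2 * Real.log (2 ^ n) ≤
        (2 ^ n) ^ 2 * (Real.log (2 ^ n + r) + 2 * Real.log 2) :=
      mul_le_mul_of_nonneg_left (by linarith) (by positivity)
    have h5 : 2 * (r : ℝ) * 2 ^ n * (Real.log (2 ^ n) + 2 * Real.log 2) ≤
        2 * r * 2 ^ n * (Real.log (2 ^ n + r) + 2 * Real.log 2) :=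
      mul_le_mul_of_nonneg_left (by linarith) (by positivity)
    linarith

theorem osc_nonneg (N : ℕ) : 0 ≤ osc N := by
  rcases Nat.eq_zero_or_pos N with rfl | hN
  · simp [osc]
  have hN : (0 : ℝ) < N := by exact_mod_cast hN
  rw [osc, sub_nonneg, le_div_iff₀ (by positivity), mul_comm]
  exact le_logMain N

theorem osc_le (N : ℕ) : osc N ≤ 2 * Real.log 2 := by
  rcases Nat.eq_zero_or_pos N with rfl | hN
  · simp only [osc, Nat.cast_zero, Real.log_zero]
    have : 0 < Real.log 2 := Real.log_pos (by norm_num)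
    simp [this.le]
  have hN : (0 : ℝ) < N := by exact_mod_cast hN
  rw [osc, sub_le_iff_le_add, div_le_iff₀ (by positivity), mul_comm, add_comm]
  exact logMain_le N

theorem osc_two_pow (n : ℕ) : osc (2 ^ n) = 0 := by
  rw [osc, logMain_two_pow]
  push_cast
  field_simp
  ring

theorem osc_three_pos : 0 < osc 3 := by
  have h := logMain_add (n := 1) (r := 1) (by norm_num)
  have h1 := logMain_two_pow 0
  norm_num at h h1
  rw [osc, h, h1, sub_pos, lt_div_iff₀ (by norm_num)]
  -- Here `logMain 3 = 16 log 2`, to be compared with `9 log 3`.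
  have h2 : Real.log ((3 : ℝ) ^ 9) < Real.log ((2 : ℝ) ^ 16) :=
    Real.log_lt_log (by norm_num) (by norm_num)
  rw [Real.log_pow, Real.log_pow] at h2
  push_cast at h2 ⊢
  linarith

/-! ### The functional `K` and the supremum `kappa` -/

theorem sum_Ioi_zero {p : ℕ} (x : Fin (p + 1) → ℝ) :
    ∑ j ∈ Finset.Ioi 0, x j = ∑ j : Fin p, x j.succ := by
  have : Finset.Ioi (0 : Fin (p + 1)) = Finset.univ.map (Fin.succEmb p) := by
    ext j
    simp only [Finset.mem_Ioi, Finset.mem_map, Finset.mem_univ, true_and, Fin.coe_succEmb]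
    exact ⟨fun h => Fin.exists_succ_eq.2 h.ne', by rintro ⟨i, rfl⟩; exact Fin.succ_pos i⟩
  rw [this, Finset.sum_map]
  rfl

theorem sum_Ioi_succ {p : ℕ} (x : Fin (p + 1) → ℝ) (i : Fin p) :
    ∑ j ∈ Finset.Ioi i.succ, x j = ∑ j ∈ Finset.Ioi i, x j.succ := by
  rw [← Fin.map_succEmb_Ioi, Finset.sum_map]
  rfl

theorem sum_sq_add_two_mul {p : ℕ} (x : Fin p → ℝ) :
    ∑ k, x k ^ 2 + 2 * ∑ k, (∑ j ∈ Finset.Ioi k, x j) * x k = (∑ k, x k) ^ 2 := by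
  induction p with
  | zero => simp
  | succ p ih =>
    have := ih fun i => x i.succ
    simp only [Fin.sum_univ_succ, sum_Ioi_zero, sum_Ioi_succ]
    linarith

theorem sum_two_pow_lt {p : ℕ} (n : Fin p → ℕ) (hn : StrictAnti n) (m : ℕ)
    (hm : ∀ i, n i < m) : ∑ i, 2 ^ n i < 2 ^ m := by
  induction p generalizing m with
  | zero => simp
  | succ p ih =>
    rw [Fin.sum_univ_succ]
    have h1 := ih (fun i => n i.succ) (fun i j h => hn (Fin.succ_lt_succ_iff.2 h)) (n 0)
      (fun i => hn (Fin.succ_pos i))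
    have h2 : 2 ^ (n 0 + 1) ≤ 2 ^ m := Nat.pow_le_pow_right (by norm_num) (hm 0)
    rw [pow_succ] at h2
    omega

theorem logMain_sum {p : ℕ} (n : Fin p → ℕ) (hn : StrictAnti n) :
    logMain (∑ i, 2 ^ n i) = ∑ k, ((2 : ℝ) ^ n k) ^ 2 * Real.log (2 ^ n k) +
      2 * ∑ k, (∑ j ∈ Finset.Ioi k, (2 : ℝ) ^ n j) *
        (2 ^ n k * (Real.log (2 ^ n k) + 2 * Real.log 2)) := by
  induction p with
  | zero => simp [logMain_zero]
  | succ p ih =>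
    have hn' : StrictAnti fun i => n (Fin.succ i) := fun i j h => hn (Fin.succ_lt_succ_iff.2 h)
    have h := ih (fun i => n i.succ) hn'
    simp only [Fin.sum_univ_succ (n := p), sum_Ioi_zero, sum_Ioi_succ]
    rw [logMain_add (sum_two_pow_lt _ hn' _ fun i => hn (Fin.succ_pos i)), h]
    push_cast
    ring

/-- Normalizing by `N` subtracts `log N + 2 log 2` with total weight `(∑ 2 ^ n i) ^ 2 = N ^ 2`, and
the leading `2 log 2` of `K` restores the constant. The case `p = 0` fails, as `K` is then `2 log
2`. -/
theorem K_eq_osc {p : ℕ} (hp : 0 < p) (n : Fin p → ℕ) (hn : StrictAnti n) {N : ℕ}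
    (hN : N = ∑ i, 2 ^ n i) : K (fun i => (2 : ℝ) ^ n i / N) = osc N := by
  have hNpos : 0 < N := by
    rw [hN]
    have : Nonempty (Fin p) := ⟨⟨0, hp⟩⟩
    exact Finset.sum_pos (fun i _ => by positivity) Finset.univ_nonempty
  have hN0 : (N : ℝ) ≠ 0 := by exact_mod_cast hNpos.ne'
  have hNx : ∑ i, (2 : ℝ) ^ n i = N := by rw [hN]; push_cast; rfl
  have hsq := sum_sq_add_two_mul fun i => (2 : ℝ) ^ n i
  rw [hNx] at hsq
  have hJ := logMain_sum n hn
  rw [← hN] at hJ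
  have hl4 : Real.log 4 = 2 * Real.log 2 := by
    rw [show (4 : ℝ) = 2 ^ 2 by norm_num, Real.log_pow]; push_cast; ring
  have h1 : ∑ k, ((2 : ℝ) ^ n k / N) ^ 2 * Real.log ((2 : ℝ) ^ n k / N / 4) =
      (∑ k, ((2 : ℝ) ^ n k) ^ 2 * Real.log (2 ^ n k) -
        (Real.log N + 2 * Real.log 2) * ∑ k, ((2 : ℝ) ^ n k) ^ 2) / (N : ℝ) ^ 2 := by
    rw [Finset.mul_sum, ← Finset.sum_sub_distrib, Finset.sum_div]
    refine Finset.sum_congr rfl fun k _ => ?_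
    rw [Real.log_div (by positivity) (by norm_num), Real.log_div (by positivity) hN0, hl4]
    field_simp
    ring
  have h2 : ∑ k, (∑ j ∈ Finset.Ioi k, (2 : ℝ) ^ n j / N) *
      ((2 : ℝ) ^ n k / N * Real.log ((2 : ℝ) ^ n k / N)) =
      (∑ k, (∑ j ∈ Finset.Ioi k, (2 : ℝ) ^ n j) *
        (2 ^ n k * (Real.log (2 ^ n k) + 2 * Real.log 2)) -
        (Real.log N + 2 * Real.log 2) *
          ∑ k, (∑ j ∈ Finset.Ioi k, (2 : ℝ) ^ n j) * 2 ^ n k) / (N : ℝ) ^ 2 := by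
    rw [Finset.mul_sum, ← Finset.sum_sub_distrib, Finset.sum_div]
    refine Finset.sum_congr rfl fun k _ => ?_
    rw [Real.log_div (by positivity) hN0, ← Finset.sum_div]
    field_simp
    ring
  rw [K, h1, h2, osc, hJ]
  field_simp
  linear_combination -(Real.log N + 2 * Real.log 2) * hsq

theorem continuous_K {p : ℕ} : Continuous (K : (Fin p → ℝ) → ℝ) := by
  have h1 : ∀ k : Fin p, Continuous fun θ : Fin p → ℝ => θ k ^ 2 * Real.log (θ k / 4) := by
    intro k
    have : Continuous fun θ : Fin p → ℝ => 4 * θ k * (θ k / 4 * Real.log (θ k / 4)) :=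
      (by fun_prop : Continuous fun θ : Fin p → ℝ => 4 * θ k).mul
        (Real.continuous_mul_log.comp (by fun_prop : Continuous fun θ : Fin p → ℝ => θ k / 4))
    refine this.congr fun θ => ?_
    ring
  have h2 : ∀ k : Fin p, Continuous fun θ : Fin p → ℝ => θ k * Real.log (θ k) :=
    fun k => Real.continuous_mul_log.comp (continuous_apply k)
  unfold K
  fun_prop

theorem exists_strictAnti_sum (N : ℕ) :
    ∃ (p : ℕ) (n : Fin p → ℕ), StrictAnti n ∧ N = ∑ i, 2 ^ n i := by
  induction N using Nat.strong_induction_on with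
  | _ N ih =>
    rcases Nat.eq_zero_or_pos N with rfl | hN
    · exact ⟨0, Fin.elim0, fun i => i.elim0, by simp⟩
    obtain ⟨m, r, hr, rfl⟩ := exists_two_pow_add hN
    obtain ⟨p, n, hn, hsum⟩ := ih r (by have : 0 < 2 ^ m := by positivity
                                        omega)
    refine ⟨p + 1, Fin.cons m n, ?_, ?_⟩
    · have hlt : ∀ i, n i < m := by
        intro i
        have h : 2 ^ n i ≤ r := by
          rw [hsum]
          exact Finset.single_le_sum (f := fun i => 2 ^ n i) (fun _ _ => Nat.zero_le _)
            (Finset.mem_univ i)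
        exact (Nat.pow_lt_pow_iff_right (a := 2) (by norm_num)).1 (h.trans_lt hr)
      intro i j hij
      induction j using Fin.cases with
      | zero => exact absurd hij (Fin.not_lt_zero i)
      | succ j =>
        induction i using Fin.cases with
        | zero => simpa using hlt j
        | succ i => simpa using hn (Fin.succ_lt_succ_iff.1 hij)
    · simp [Fin.sum_univ_succ, ← hsum]

theorem osc_mem_valuesK {N : ℕ} (hN : 0 < N) : osc N ∈ valuesK := by
  obtain ⟨p, n, hn, hsum⟩ := exists_strictAnti_sum N
  have hp : 0 < p := by
    rcases Nat.eq_zero_or_pos p with rfl | hp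
    · simp at hsum; omega
    · exact hp
  refine ⟨p, hp, fun i => (2 : ℝ) ^ n i / N, ?_, (K_eq_osc hp n hn hsum).symm⟩
  -- Multiplication by `2 ^ m` shifts the digits and leaves the ratios unchanged.
  refine ⟨fun m => 2 ^ m * N, fun m i => m + n i, ?_, fun m => ⟨?_, ?_⟩, fun i => ?_⟩
  · intro m m' h
    exact Nat.mul_lt_mul_of_pos_right (Nat.pow_lt_pow_right (by norm_num) h) hN
  · intro i j h
    simpa using hn h
  · simp only [pow_add, ← Finset.mul_sum, ← hsum]
  · refine tendsto_const_nhds.congr fun m => ?_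
    push_cast
    rw [pow_add, mul_div_mul_left _ _ (by positivity)]

theorem exists_tendsto_osc {x : ℝ} (hx : x ∈ valuesK) :
    ∃ N : ℕ → ℕ, StrictMono N ∧ Tendsto (fun m => osc (N m)) atTop (𝓝 x) := by
  obtain ⟨p, hp, θ, ⟨N, n, hN, hn, hlim⟩, rfl⟩ := hx
  refine ⟨N, hN, ?_⟩
  have h := (continuous_K.tendsto θ).comp (tendsto_pi_nhds.2 hlim)
  refine h.congr fun m => ?_
  exact K_eq_osc hp (n m) (hn m).1 (hn m).2

theorem isLUB_kappa : IsLUB valuesK kappa := by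
  refine isLUB_csSup ⟨_, osc_mem_valuesK one_pos⟩ ⟨2 * Real.log 2, fun x hx => ?_⟩
  obtain ⟨N, -, h⟩ := exists_tendsto_osc hx
  exact le_of_tendsto' h fun m => osc_le _

/-! ### Upper and lower limits -/

theorem ereal_limsup_eq {u : ℕ → ℝ} {L : ℝ} (h1 : ∀ ε > 0, ∀ᶠ N in atTop, u N ≤ L + ε)
    (h2 : ∀ ε > 0, ∃ᶠ N in atTop, L - ε ≤ u N) :
    limsup (fun N => (u N : EReal)) atTop = (L : EReal) := by
  apply le_antisymm
  · refine EReal.le_of_forall_lt_iff_le.1 fun z hz => ?_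
    have hz : L < z := by exact_mod_cast hz
    refine limsup_le_of_le (by isBoundedDefault) ?_
    filter_upwards [h1 (z - L) (by linarith)] with N hN
    exact_mod_cast (by linarith : u N ≤ z)
  · refine EReal.ge_of_forall_gt_iff_ge.1 fun z hz => ?_
    have hz : z < L := by exact_mod_cast hz
    refine le_limsup_of_frequently_le' ?_
    refine (h2 (L - z) (by linarith)).mono fun N hN => ?_
    exact_mod_cast (by linarith : z ≤ u N)

theorem ereal_liminf_eq {u : ℕ → ℝ} {L : ℝ} (h1 : ∀ ε > 0, ∀ᶠ N in atTop, L - ε ≤ u N)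
    (h2 : ∀ ε > 0, ∃ᶠ N in atTop, u N ≤ L + ε) :
    liminf (fun N => (u N : EReal)) atTop = (L : EReal) := by
  apply le_antisymm
  · refine EReal.le_of_forall_lt_iff_le.1 fun z hz => ?_
    have hz : L < z := by exact_mod_cast hz
    refine liminf_le_of_frequently_le' ?_
    refine (h2 (z - L) (by linarith)).mono fun N hN => ?_
    exact_mod_cast (by linarith : u N ≤ z)
  · refine EReal.ge_of_forall_gt_iff_ge.1 fun z hz => ?_
    have hz : z < L := by exact_mod_cast hz
    refine le_liminf_of_le (by isBoundedDefault) ?_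
    filter_upwards [h1 (L - z) (by linarith)] with N hN
    exact_mod_cast (by linarith : z ≤ u N)

theorem kappa_pos : 0 < kappa :=
  osc_three_pos.trans_le (isLUB_kappa.1 (osc_mem_valuesK (by norm_num)))

theorem IsGreedySeq.tendsto_normalizedEnergy_sub {a : ℕ → ℂ} (ha : IsGreedySeq 1 a) :
    Tendsto (fun N => normalizedEnergy a N - 1 / Real.pi * (rootConst + osc N)) atTop (𝓝 0) := by
  refine tendsto_energyErr.congr' ?_
  filter_upwards [eventually_gt_atTop 0] with N hN
  rw [ha.normalizedEnergy_eq hN]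
  ring

theorem IsGreedySeq.tendsto_normalizedEnergy_comp {a : ℕ → ℂ} (ha : IsGreedySeq 1 a) {N : ℕ → ℕ}
    (hN : StrictMono N) {x : ℝ} (hx : Tendsto (fun m => osc (N m)) atTop (𝓝 x)) :
    Tendsto (fun m => normalizedEnergy a (N m)) atTop (𝓝 (1 / Real.pi * (rootConst + x))) := by
  have h := (ha.tendsto_normalizedEnergy_sub.comp hN.tendsto_atTop).add
    ((hx.const_add rootConst).const_mul (1 / Real.pi))
  simpa using h

theorem IsGreedySeq.limsup_normalizedEnergy {a : ℕ → ℂ} (ha : IsGreedySeq 1 a) :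
    limsup (fun N => (normalizedEnergy a N : EReal)) atTop =
      ((1 / Real.pi * (rootConst + kappa) : ℝ) : EReal) := by
  have hpi : 0 < 1 / Real.pi := by positivity
  refine ereal_limsup_eq (fun ε hε => ?_) fun ε hε => ?_
  · filter_upwards [ha.tendsto_normalizedEnergy_sub.eventually_lt_const hε,
      eventually_gt_atTop 0] with N h hN
    have h1 := mul_le_mul_of_nonneg_left (isLUB_kappa.1 (osc_mem_valuesK hN)) hpi.le
    rw [mul_add] at h ⊢
    linarith
  · obtain ⟨x, hx, hlt, -⟩ := isLUB_kappa.exists_between (b := kappa - ε * Real.pi)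
      (by have := mul_pos hε Real.pi_pos; linarith)
    obtain ⟨N, hN, hlim⟩ := exists_tendsto_osc hx
    refine hN.tendsto_atTop.frequently (Eventually.frequently ?_)
    refine ((ha.tendsto_normalizedEnergy_comp hN hlim).eventually_const_lt ?_).mono
      fun m hm => hm.le
    have h1 := mul_lt_mul_of_pos_left hlt hpi
    have h2 : 1 / Real.pi * (kappa - ε * Real.pi) = 1 / Real.pi * kappa - ε := by
      field_simp
    rw [mul_add, mul_add]
    linarith

theorem IsGreedySeq.liminf_normalizedEnergy {a : ℕ → ℂ} (ha : IsGreedySeq 1 a) :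
    liminf (fun N => (normalizedEnergy a N : EReal)) atTop =
      ((1 / Real.pi * rootConst : ℝ) : EReal) := by
  have hpi : 0 < 1 / Real.pi := by positivity
  refine ereal_liminf_eq (fun ε hε => ?_) fun ε hε => ?_
  · filter_upwards [ha.tendsto_normalizedEnergy_sub.eventually_const_lt (neg_lt_zero.2 hε)]
      with N h
    have h1 := mul_nonneg hpi.le (osc_nonneg N)
    rw [mul_add] at h
    linarith
  · have hN : StrictMono fun m : ℕ => 2 ^ m := pow_right_strictMono₀ one_lt_two
    refine hN.tendsto_atTop.frequently (Eventually.frequently ?_)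
    have hlim : Tendsto (fun m => osc (2 ^ m)) atTop (𝓝 0) := by simp [osc_two_pow]
    have h := ha.tendsto_normalizedEnergy_comp hN hlim
    rw [add_zero] at h
    exact (h.eventually_lt_const (by linarith)).mono fun m hm => hm.le

end GreedyCircle

end

theorem theorem5 (a : ℕ → ℂ) (ha : GreedyCircle.IsGreedySeq 1 a) :
    -- the energies are finite, and `κ` is a genuine (finite) supremum
    (∀ N, GreedyCircle.energy 1 a N ≠ ⊤) ∧
    IsLUB GreedyCircle.valuesK GreedyCircle.kappa ∧
    -- the upper and the lower limit
    limsup (fun N : ℕ => (GreedyCircle.normalizedEnergy a N : EReal)) atTop =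
      ((1 / Real.pi * (Real.eulerMascheroniConstant - Real.log (Real.pi / 2)
        + GreedyCircle.kappa) : ℝ) : EReal) ∧
    liminf (fun N : ℕ => (GreedyCircle.normalizedEnergy a N : EReal)) atTop =
      ((1 / Real.pi * (Real.eulerMascheroniConstant - Real.log (Real.pi / 2)) : ℝ) : EReal) ∧
    -- hence there is no limit
    0 < GreedyCircle.kappa ∧
    ¬ ∃ l : ℝ, Tendsto (GreedyCircle.normalizedEnergy a) atTop (𝓝 l) := by
  refine ⟨fun N => ?_, GreedyCircle.isLUB_kappa, ha.limsup_normalizedEnergy,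
    ha.liminf_normalizedEnergy, GreedyCircle.kappa_pos, ?_⟩
  · rw [ha.energy_eq]
    exact ENNReal.ofReal_ne_top
  · rintro ⟨l, hl⟩
    have hl' := EReal.tendsto_coe.2 hl
    have h1 := ha.limsup_normalizedEnergy.symm.trans hl'.limsup_eq
    have h2 := ha.liminf_normalizedEnergy.symm.trans hl'.liminf_eq
    have h := h1.trans h2.symm
    rw [EReal.coe_eq_coe_iff] at h
    have hpi : 0 < 1 / Real.pi := by have := Real.pi_pos; positivity
    have := mul_left_cancel₀ hpi.ne' h
    linarith [GreedyCircle.kappa_pos]
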